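/- Let $d,m,\ell\ge 0$ be integers, let $\Lambda\subset\mathbb{R}^d$ be a full-rank lattice, let $\Omega\subset\mathbb{R}^d$ be any set, and let $\mathcal F=(f_1,\dots,f_m)$ be data in $L^2(\mathbb{R}^d)=L^2(\mathbb{R}^d;\mathbb{C})$. For $\lambda\in\mathbb{R}^d$ let $t_\lambda f(x)=f(x-\lambda)$, and for $\Phi\subset L^2(\mathbb{R}^d)$ let $S(\Phi)=\overline{\operatorname{span}}\{t_\lambda\varphi:\lambda\in\Lambda,\ \varphi\in\Phi\}$. A closed subspace $S$ of $L^2(\mathbb{R}^d)$ is $\Lambda$-shift-invariant if $t_\lambda S\subset S$ for all $\lambda\in\Lambda$; its length is the smallest cardinality of a set $\Phi$ with $S=S(\Phi)$. Let $\mathcal C_\ell(\mathbb{R}^d)$ be the class of $\Lambda$-shift-invariant spaces of length at most $\ell$. Let $PW_\Omega$ be the (closed) space of all $f\in L^2(\mathbb{R}^d)$ whose Fourier transform $\hat f$ vanishes almost everywhere on $\mathbb{R}^d\setminus\Omega$, where $\hat f(\omega)=\int f(x)e^{-2\pi i\langle x,\omega\rangle}\,dx$, extended to $L^2(\mathbb{R}^d)$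 by Plancherel. Let $\mathcal C_\ell(\Omega)$ be the class of all $S\in\mathcal C_\ell(\mathbb{R}^d)$ with $S\subset PW_\Omega$. Write $\mathbb P_S$ for the orthogonal projection onto a closed subspace $S$, and $$\mathcal E(\mathcal F,S)=\sum_{i=1}^m\|f_i-\mathbb P_S f_i\|^2 .$$ Then there is $\Phi=\{\varphi_1,\dots,\varphi_\ell\}\subset L^2(\mathbb{R}^d)$ with $S(\Phi)\in\mathcal C_\ell(\Omega)$ such that (a) $\mathcal E(\mathcal F,S(\Phi))\le\mathcal E(\mathcal F,S(\Psi))$ for all $\Psi=\{\psi_1,\dots,\psi_\ell\}\subset PW_\Omega$; and (b) $S(\Phi)$ is an optimal shift-invariant space for the projected data $\mathbb P_{PW_\Omega}\mathcal F=(\mathbb P_{PW_\Omega}f_1,\dots,\mathbb P_{PW_\Omega}f_m)$, that is, $\mathcal E(\mathbb P_{PW_\Omega}\mathcal F,S(\Phi))\le\mathcal E(\mathbb P_{PW_\Omega}\mathcal F,S)$ for all $S\in\mathcal C_\ell(\mathbb{R}^d)$. -/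

import Mathlib

open MeasureTheory FourierTransform

noncomputable section

namespace ShiftInvariant

/-- The Euclidean space `ℝ^d`. -/
abbrev Rd (d : ℕ) : Type := EuclideanSpace ℝ (Fin d)

/-- The complex Hilbert space `L²(ℝ^d)` with respect to Lebesgue measure. -/
abbrev L2 (d : ℕ) : Type := Lp ℂ 2 (volume : Measure (Rd d))

/-- The translation `t_v f (x) = f (x - v)` on `L²(ℝ^d)`. -/
def translate {d : ℕ} (v : Rd d) (f : L2 d) : L2 d :=
  Lp.compMeasurePreserving (fun x : Rd d => x - v) (measurePreserving_sub_right volume v) f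

/-- The closed linear span `S_Λ(Φ)` of the `Λ`-translates of the elements of `Φ`. -/
def shiftSpan {d : ℕ} (Λ : Submodule ℤ (Rd d)) (Φ : Set (L2 d)) : ClosedSubmodule ℂ (L2 d) :=
  (Submodule.span ℂ {g : L2 d | ∃ v ∈ Λ, ∃ φ ∈ Φ, g = translate v φ}).closure

/-- A closed subspace of `L²(ℝ^d)` is `Λ`-shift-invariant if it is stable under translation
by every vector of `Λ`. -/
def IsShiftInvariant {d : ℕ} (Λ : Submodule ℤ (Rd d)) (S : ClosedSubmodule ℂ (L2 d)) : Prop :=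
  ∀ v ∈ Λ, ∀ f ∈ S, translate v f ∈ S

/-- The length of a closed subspace: the minimal cardinality of a set `Φ` with `S_Λ(Φ) = S`
(it is `⊤` if there is no finite such set). -/
def length {d : ℕ} (Λ : Submodule ℤ (Rd d)) (S : ClosedSubmodule ℂ (L2 d)) : ℕ∞ :=
  ⨅ Φ : {Φ : Set (L2 d) // shiftSpan Λ Φ = S}, Φ.1.encard

/-- The class `C_ℓ(ℝ^d)` of `Λ`-shift-invariant spaces of length at most `ℓ`. -/
def sisClass {d : ℕ} (Λ : Submodule ℤ (Rd d)) (ℓ : ℕ) : Set (ClosedSubmodule ℂ (L2 d)) :=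
  {S | IsShiftInvariant Λ S ∧ length Λ S ≤ ℓ}

/-- The Paley-Wiener space of all `f ∈ L²(ℝ^d)` whose Fourier transform vanishes
almost everywhere outside `Ω`. -/
def paleyWiener {d : ℕ} (Ω : Set (Rd d)) : ClosedSubmodule ℂ (L2 d) where
  carrier := {f | ∀ᵐ ω : Rd d, ω ∉ Ω → (𝓕 f : L2 d) ω = 0}
  add_mem' := by
    intro f g hf hg
    simp only [Set.mem_ofPred_eq] at hf hg ⊢
    rw [FourierTransform.fourier_add]
    filter_upwards [hf, hg, Lp.coeFn_add (𝓕 f : L2 d) (𝓕 g : L2 d)] with ω h1 h2 h3 hω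
    rw [h3, Pi.add_apply, h1 hω, h2 hω, add_zero]
  zero_mem' := by
    have h0 : (𝓕 (0 : L2 d) : L2 d) = 0 := (Lp.fourierTransformₗᵢ (Rd d) ℂ).map_zero
    simp only [Set.mem_ofPred_eq]
    rw [h0]
    filter_upwards [Lp.coeFn_zero ℂ 2 (volume : Measure (Rd d))] with ω h _
    rw [h, Pi.zero_apply]
  smul_mem' := by
    intro c f hf
    simp only [Set.mem_ofPred_eq] at hf ⊢
    rw [FourierTransform.fourier_smul]
    filter_upwards [hf, Lp.coeFn_smul c (𝓕 f : L2 d)] with ω h1 h2 hω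
    rw [h2, Pi.smul_apply, h1 hω, smul_zero]
  isClosed' := by
    have key : {f : L2 d | ∀ᵐ ω : Rd d, ω ∉ Ω → (𝓕 f : L2 d) ω = 0} =
        (fun f : L2 d => LpToLpRestrictCLM (Rd d) ℂ ℂ volume 2 Ωᶜ (𝓕 f : L2 d)) ⁻¹' {0} := by
      ext f
      have hm : MeasurableSet {ω : Rd d | (𝓕 f : L2 d) ω = 0} :=
        (Lp.stronglyMeasurable (𝓕 f : L2 d)).measurable (measurableSet_singleton 0)
      have h1 := ae_restrict_iff (μ := (volume : Measure (Rd d))) (s := Ωᶜ) hm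
      have h2 := LpToLpRestrictCLM_coeFn (μ := (volume : Measure (Rd d))) (p := 2) ℂ Ωᶜ
        (𝓕 f : L2 d)
      simp only [Set.mem_compl_iff] at h1
      simp only [Set.mem_ofPred_eq, Set.mem_preimage, Set.mem_singleton_iff]
      rw [← h1, Lp.eq_zero_iff_ae_eq_zero]
      constructor
      · intro h
        filter_upwards [h, h2] with ω ha hb
        rw [hb, ha, Pi.zero_apply]
      · intro h
        filter_upwards [h, h2] with ω ha hb
        rw [← hb, ha, Pi.zero_apply]
    change IsClosed {f : L2 d | ∀ᵐ ω : Rd d, ω ∉ Ω → (𝓕 f : L2 d) ω = 0}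
    rw [key]
    exact isClosed_singleton.preimage
      ((LpToLpRestrictCLM (Rd d) ℂ ℂ volume 2 Ωᶜ).continuous.comp
        (Lp.fourierTransformₗᵢ (Rd d) ℂ).continuous)

/-- The class `C_ℓ(Ω)` of `Λ`-shift-invariant spaces of length at most `ℓ` that are contained
in the Paley-Wiener space of `Ω`. -/
def sisClassPW {d : ℕ} (Λ : Submodule ℤ (Rd d)) (ℓ : ℕ) (Ω : Set (Rd d)) :
    Set (ClosedSubmodule ℂ (L2 d)) :=
  {S | S ∈ sisClass Λ ℓ ∧ S ≤ paleyWiener Ω}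

/-- The orthogonal projection of `L²(ℝ^d)` onto a closed subspace. -/
def proj {d : ℕ} (S : ClosedSubmodule ℂ (L2 d)) (f : L2 d) : L2 d :=
  S.toSubmodule.starProjection f

/-- The approximation error `∑ i, ‖f_i - P_S f_i‖²`. -/
def error {d m : ℕ} (F : Fin m → L2 d) (S : ClosedSubmodule ℂ (L2 d)) : ℝ :=
  ∑ i, ‖F i - proj S (F i)‖ ^ 2

end ShiftInvariant

end

/-! By Pythagoras (`error_eq_add_error_proj`), for S inside the Paley-Wiener space the error for F
is a term independent of S plus the error for the projected data g. So (a) and (b) both follow from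
one space that is optimal for g among all spaces of length at most ℓ, provided that it lies in the
Paley-Wiener space.

On the Fourier side a lattice translation is multiplication by a character, hence by a function of
q(ω) = `torusMap b ω`, where b generates Λ. Up to limits, approximating g from S(Ψ) means
approximating the vector ĝ(ω) ∈ ℂ^m by ∑ ψ̂_k(ω) A_k(q(ω)). Once the A_k are fixed, nothing beats
projecting ĝ(ω) onto their span. What remains is to choose, measurably in t, ℓ vectors v_k(t) in ℂ^m
with least total residual ĝ - ∑ ⟪v_k(q), ĝ⟫ v_k(q). Orthonormality is relaxed to contractivity of
the residual map, which leaves a compact set of admissible families.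

A minimizer exists by disintegration over q and measurable selection
(`exists_measurable_minimizer_residual`). Its energy bounds every error from below
(`lintegral_frameResidual_le_error`), and the generators φ̂_k = ⟪v_k(q), ĝ⟫ do at least as well
(`exists_generators_error_le`). They vanish wherever ĝ does, so they lie in the Paley-Wiener space.
-/

open scoped ENNReal

/-! ### Measurable selection of minimizers -/

/-- A Carathéodory function attains its minimum over a compact set measurably. -/
lemma exists_measurable_isLeast_image {X T : Type*} [MetricSpace X] [MeasurableSpace T]
    {D : Set X} (hD : IsCompact D) (hne : D.Nonempty) (c : X → T → ℝ≥0∞)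
    (hc : ∀ t, ContinuousOn (c · t) D) (hm : ∀ x, Measurable (c x)) :
    ∃ M : T → ℝ≥0∞, Measurable M ∧ ∀ t, IsLeast ((c · t) '' D) (M t) := by
  have : CompactSpace D := isCompact_iff_compactSpace.mp hD
  have : Nonempty D := hne.to_subtype
  have hcD : ∀ t, Continuous fun x : D ↦ c x t := fun t ↦
    continuousOn_iff_continuous_domRestrict.mp (hc t)
  -- By continuity the infimum over a countable dense subset is the minimum, and a countable infimum
  -- is measurable.
  refine ⟨fun t ↦ ⨅ n, c (TopologicalSpace.denseSeq D n) t,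
    Measurable.iInf fun n ↦ hm _, fun t ↦ ?_⟩
  obtain ⟨x, hx, hxmin⟩ := hD.exists_isMinOn hne (hc t)
  have hlow : ∀ y : D, ⨅ n, c (TopologicalSpace.denseSeq D n) t ≤ c y t := by
    intro y
    have hcl : IsClosed {y : D | ⨅ n, c (TopologicalSpace.denseSeq D n) t ≤ c y t} :=
      isClosed_le continuous_const (hcD t)
    refine (TopologicalSpace.denseRange_denseSeq D).induction_on
      (p := fun y ↦ ⨅ n, c (TopologicalSpace.denseSeq D n) t ≤ c y t) y hcl fun n ↦ iInf_le _ n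
  have heq : ⨅ n, c (TopologicalSpace.denseSeq D n) t = c x t :=
    le_antisymm (hlow ⟨x, hx⟩) (le_iInf fun n ↦ hxmin (TopologicalSpace.denseSeq D n).2)
  refine ⟨⟨x, hx, heq.symm⟩, ?_⟩
  rintro _ ⟨y, hy, rfl⟩
  exact hlow ⟨y, hy⟩

/-- Measurable selection of a minimizer over a compact set of reals. -/
lemma exists_measurable_argmin_real {T : Type*} [MeasurableSpace T]
    {D : Set ℝ} (hD : IsCompact D) (hne : D.Nonempty) (c : ℝ → T → ℝ≥0∞)
    (hc : ∀ t, ContinuousOn (c · t) D) (hm : ∀ x, Measurable (c x)) :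
    ∃ s : T → ℝ, Measurable s ∧ ∀ t, s t ∈ D ∧ ∀ x ∈ D, c (s t) t ≤ c x t := by
  obtain ⟨M, hM, hMleast⟩ := exists_measurable_isLeast_image hD hne c hc hm
  set Z : T → Set ℝ := fun t ↦ D ∩ {x | c x t ≤ M t} with hZ
  have hZc : ∀ t, IsCompact (Z t) := fun t ↦
    hD.of_isClosed_subset ((hc t).preimage_isClosed_of_isClosed hD.isClosed isClosed_Iic)
      Set.inter_subset_left
  have hZne : ∀ t, (Z t).Nonempty := fun t ↦ by
    obtain ⟨x, hx, hxe⟩ := (hMleast t).1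
    exact ⟨x, hx, hxe.le⟩
  have hmem : ∀ t, sInf (Z t) ∈ Z t := fun t ↦ (hZc t).sInf_mem (hZne t)
  refine ⟨fun t ↦ sInf (Z t), ?_, fun t ↦ ⟨(hmem t).1, fun x hx ↦
    (hmem t).2.trans ((hMleast t).2 ⟨x, hx, rfl⟩)⟩⟩
  refine measurable_of_Iic fun a ↦ ?_
  rcases (D ∩ Set.Iic a).eq_empty_or_nonempty with he | hne'
  · convert MeasurableSet.empty
    ext t
    simp only [Set.mem_preimage, Set.mem_Iic, Set.mem_empty_iff_false, iff_false]
    intro h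
    exact (he ▸ ⟨(hmem t).1, h⟩ : sInf (Z t) ∈ (∅ : Set ℝ))
  -- The least minimizer is at most `a` exactly when the minimum over `D ∩ Iic a` does not exceed
  -- the minimum over `D`; both minima are measurable in `t`.
  · obtain ⟨N, hN, hNleast⟩ := exists_measurable_isLeast_image (hD.inter_right isClosed_Iic) hne' c
      (fun t ↦ (hc t).mono Set.inter_subset_left) hm
    convert measurableSet_le hN hM
    ext t
    simp only [Set.mem_preimage, Set.mem_Iic]
    constructor
    · intro h
      exact ((hNleast t).2 ⟨_, ⟨(hmem t).1, h⟩, rfl⟩).trans (hmem t).2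
    · intro h
      obtain ⟨x, hx, hxe⟩ := (hNleast t).1
      have hxZ : x ∈ Z t := ⟨hx.1, hxe.le.trans h⟩
      exact (csInf_le (hZc t).bddBelow hxZ).trans hx.2

/-- Measurable selection of a minimizer of a Carathéodory function on a compact metric space. -/
lemma exists_measurable_argmin {K T : Type*} [MetricSpace K] [CompactSpace K] [Nonempty K]
    [MeasurableSpace K] [BorelSpace K] [MeasurableSpace T] (c : K → T → ℝ≥0∞)
    (hc : ∀ t, Continuous (c · t)) (hm : ∀ x, Measurable (c x)) :
    ∃ s : T → K, Measurable s ∧ ∀ t x, c (s t) t ≤ c x t := by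
  classical
  obtain ⟨f, hf, hfs⟩ := exists_nat_bool_continuous_surjective_of_compact K
  -- Every nonempty compact metric space is a continuous image of the Cantor set, so the real case
  -- applies. The value 0 of `c'` off the Cantor set is never compared.
  set p : cantorSet → K := f ∘ cantorSetHomeomorphNatToBool
  have hp : Continuous p := hf.comp cantorSetHomeomorphNatToBool.continuous
  have hps : Function.Surjective p := hfs.comp cantorSetHomeomorphNatToBool.surjective
  set c' : ℝ → T → ℝ≥0∞ := fun x ↦ if h : x ∈ cantorSet then c (p ⟨x, h⟩) else 0
  have hc' : ∀ x : cantorSet, c' x = c (p x) := fun x ↦ dif_pos x.2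
  obtain ⟨s, hs, hsmin⟩ := exists_measurable_argmin_real isCompact_cantorSet
    ⟨0, zero_mem_cantorSet⟩ c'
    (fun t ↦ by
      rw [continuousOn_iff_continuous_domRestrict]
      have : cantorSet.domRestrict (c' · t) = fun x ↦ c (p x) t := by
        ext x
        simp [hc']
      rw [this]
      exact (hc t).comp hp)
    (fun x ↦ by
      by_cases h : x ∈ cantorSet
      · simpa only [c', dif_pos h] using hm _
      · simp only [c', dif_neg h]
        exact measurable_const)
  refine ⟨fun t ↦ p ⟨s t, (hsmin t).1⟩,
    hp.measurable.comp (hs.subtype_mk (h := fun t ↦ (hsmin t).1)), fun t x ↦ ?_⟩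
  obtain ⟨y, rfl⟩ := hps x
  have := (hsmin t).2 y y.2
  rwa [hc', show c' (s t) = _ from hc' ⟨s t, (hsmin t).1⟩] at this

/-! ### Contractive frames and their residuals -/

section Residual

variable {E : Type*} [NormedAddCommGroup E] [InnerProductSpace ℂ E] {ℓ : ℕ}

/-- The residual `x - ∑ ⟪v_k, x⟫ v_k` of `x` with respect to a family `v`. -/
noncomputable def frameResidual (v : Fin ℓ → E) (x : E) : E := x - ∑ k, inner ℂ (v k) x • v k

/-- The families of vectors in the unit ball for which taking residuals is a contraction. -/
def contractiveFrames (E : Type*) [NormedAddCommGroup E] [InnerProductSpace ℂ E] (ℓ : ℕ) :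
    Set (Fin ℓ → E) :=
  {v | (∀ k, ‖v k‖ ≤ 1) ∧ ∀ x, ‖frameResidual v x‖ ≤ ‖x‖}

@[fun_prop]
lemma Continuous.frameResidual {α : Type*} [TopologicalSpace α] {v : α → Fin ℓ → E} {x : α → E}
    (hv : Continuous v) (hx : Continuous x) : Continuous fun a ↦ frameResidual (v a) (x a) := by
  unfold _root_.frameResidual
  fun_prop

lemma frameResidual_sub (v : Fin ℓ → E) (x y : E) :
    frameResidual v (x - y) = frameResidual v x - frameResidual v y := by
  simp only [frameResidual, inner_sub_right, sub_smul, Finset.sum_sub_distrib]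
  abel

lemma frameResidual_smul (v : Fin ℓ → E) (c : ℂ) (x : E) :
    frameResidual v (c • x) = c • frameResidual v x := by
  simp only [frameResidual, inner_smul_right, smul_sub, Finset.smul_sum, smul_smul]

lemma frameResidual_sum {ι : Type*} (s : Finset ι) (v : Fin ℓ → E) (x : ι → E) :
    frameResidual v (∑ i ∈ s, x i) = ∑ i ∈ s, frameResidual v (x i) := by
  simp only [frameResidual, inner_sum, Finset.sum_sub_distrib, Finset.sum_smul]
  rw [Finset.sum_comm]

/-- For each `k` and each `x` the condition is closed in `v`, and the norm bounds confine `v` to a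
product of compact balls. -/
lemma isCompact_contractiveFrames [FiniteDimensional ℂ E] :
    IsCompact (contractiveFrames E ℓ) := by
  have : ProperSpace E := FiniteDimensional.proper ℂ E
  refine (isCompact_univ_pi fun _ : Fin ℓ ↦ isCompact_closedBall (0 : E) 1).of_isClosed_subset
    ?_ fun v hv k _ ↦ mem_closedBall_zero_iff.mpr (hv.1 k)
  have : contractiveFrames E ℓ =
      (⋂ k, {v | ‖v k‖ ≤ 1}) ∩ ⋂ x, {v | ‖frameResidual v x‖ ≤ ‖x‖} := by
    ext v
    simp [contractiveFrames]
  rw [this]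
  refine (isClosed_iInter fun k ↦ ?_).inter (isClosed_iInter fun x ↦ ?_)
  · exact isClosed_le (by fun_prop) continuous_const
  · exact isClosed_le (continuous_id.frameResidual continuous_const).norm continuous_const

/-- The span of `A` has dimension at most ℓ. An orthonormal basis of it, padded with zeros to ℓ
vectors, has as residual map the orthogonal projection onto the complement of the span. -/
lemma exists_contractiveFrames_residual_eq_zero (A : Fin ℓ → E) :
    ∃ v ∈ contractiveFrames E ℓ, ∀ k, frameResidual v (A k) = 0 := by
  classical
  set W : Submodule ℂ E := Submodule.span ℂ (Set.range A)
  have hfin : FiniteDimensional ℂ W := FiniteDimensional.span_of_finite ℂ (Set.finite_range A)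
  set b := stdOrthonormalBasis ℂ W
  have hr : Module.finrank ℂ W ≤ ℓ := by
    simpa [Set.finrank] using finrank_range_le_card (R := ℂ) A
  set v : Fin ℓ → E := fun k ↦ if h : k.1 < Module.finrank ℂ W then (b ⟨k, h⟩ : E) else 0 with hv
  have hsum : ∀ x, ∑ k, inner ℂ (v k) x • v k = W.starProjection x := by
    intro x
    have h1 : W.starProjection x = ∑ j, inner ℂ (b j : E) x • (b j : E) := by
      simp [Submodule.starProjection_apply, b.orthogonalProjectionOnto_apply_eq_sum]
    rw [h1]
    symm
    refine Finset.sum_of_injOn (Fin.castLE hr) (Fin.castLE_injective hr).injOn (by simp) ?_ ?_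
    · intro k _ hk
      have : ¬ k.1 < Module.finrank ℂ W := fun h ↦ hk ⟨⟨k, h⟩, by simp, rfl⟩
      simp [hv, this]
    · intro j _
      simp [hv]
  have hres : ∀ x, frameResidual v x = x - W.starProjection x := fun x ↦ by rw [frameResidual, hsum]
  refine ⟨v, ⟨fun k ↦ ?_, fun x ↦ ?_⟩, fun k ↦ ?_⟩
  · simp only [hv]
    split_ifs with h
    · exact (b.orthonormal.1 ⟨k, h⟩).le
    · simp
  · rw [hres, ← Submodule.starProjection_orthogonal_val]
    exact Submodule.norm_starProjection_apply_le _ x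
  · rw [hres, Submodule.starProjection_eq_self_iff.mpr
      (Submodule.subset_span (Set.mem_range_self k)), sub_self]

end Residual

/-! ### Optimal frames depending measurably on a parameter -/

section Selection

open ProbabilityTheory

variable {E : Type*} [NormedAddCommGroup E] [InnerProductSpace ℂ E] [FiniteDimensional ℂ E]
  [MeasurableSpace E] [BorelSpace E] {ℓ : ℕ}

instance : CompactSpace (contractiveFrames E ℓ) :=
  isCompact_iff_compactSpace.mp isCompact_contractiveFrames

instance : Nonempty (contractiveFrames E ℓ) :=
  let ⟨v, hv, _⟩ := exists_contractiveFrames_residual_eq_zero (0 : Fin ℓ → E)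
  ⟨⟨v, hv⟩⟩

instance : BorelSpace (contractiveFrames E ℓ) :=
  have : ProperSpace E := FiniteDimensional.proper ℂ E
  inferInstance

lemma Measurable.frameResidual {α : Type*} [MeasurableSpace α] {v : α → Fin ℓ → E} {x : α → E}
    (hv : Measurable v) (hx : Measurable x) : Measurable fun a ↦ frameResidual (v a) (x a) := by
  have : ProperSpace E := FiniteDimensional.proper ℂ E
  have h : Continuous fun p : (Fin ℓ → E) × E ↦ _root_.frameResidual p.1 p.2 := by
    fun_prop
  exact h.measurable.comp (hv.prodMk hx)

/-- Given measurable families `A`, a contractive frame annihilating `A` can be chosen measurably. -/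
lemma exists_measurable_residual_eq_zero {T : Type*} [MeasurableSpace T] {A : T → Fin ℓ → E}
    (hA : Measurable A) :
    ∃ v : T → contractiveFrames E ℓ, Measurable v ∧ ∀ t k, frameResidual (v t).1 (A t k) = 0 := by
  -- The total residual of `A t` has minimum 0 for every `t`, so a measurable minimizer annihilates
  -- `A t`.
  obtain ⟨v, hv, hmin⟩ := exists_measurable_argmin
    (fun (v : contractiveFrames E ℓ) t ↦ ∑ k, ‖frameResidual v.1 (A t k)‖ₑ)
    (fun t ↦ by fun_prop)
    (fun v ↦ Finset.measurable_sum _ fun k _ ↦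
      (Measurable.frameResidual measurable_const ((measurable_pi_apply k).comp hA)).enorm)
  refine ⟨v, hv, fun t k ↦ ?_⟩
  obtain ⟨w, hw, hw0⟩ := exists_contractiveFrames_residual_eq_zero (A t)
  have := hmin t ⟨w, hw⟩
  simp only [hw0, enorm_zero, Finset.sum_const_zero, nonpos_iff_eq_zero, Finset.sum_eq_zero_iff,
    Finset.mem_univ, enorm_eq_zero, true_implies] at this
  exact this k

/-- Bounded Carathéodory integrands have a measurable minimizer under conditioning on `q`. -/
lemma exists_measurable_minimizer_lintegral {X T K Y : Type*} [MeasurableSpace X]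
    [MeasurableSpace T] [TopologicalSpace Y] [MeasurableSpace Y] [BorelSpace Y]
    [StandardBorelSpace Y] [Nonempty Y] [MeasurableSpace.CountableOrCountablyGenerated T Y]
    [MetricSpace K] [CompactSpace K] [Nonempty K] [MeasurableSpace K] [BorelSpace K]
    {μ : Measure X} [IsFiniteMeasure μ] {q : X → T} (hq : Measurable q) {u : X → Y}
    (hu : Measurable u) (c : K → Y → ℝ≥0∞) (hc : ∀ y, Continuous (c · y))
    (hm : Measurable fun p : K × Y ↦ c p.1 p.2) (hb : ∀ k y, c k y ≤ 1) :
    ∃ s : T → K, Measurable s ∧ ∀ s' : T → K, Measurable s' →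
      ∫⁻ x, c (s (q x)) (u x) ∂μ ≤ ∫⁻ x, c (s' (q x)) (u x) ∂μ := by
  set ρ : Measure (T × Y) := μ.map fun x ↦ (q x, u x)
  have hρ : IsFiniteMeasure ρ := Measure.isFiniteMeasure_map _ _
  -- Conditioning on `q = t` turns the integral into an average over `t` of costs in `s t` alone,
  -- which can be minimized pointwise. The bound 1 makes these costs continuous in `k` by dominated
  -- convergence.
  obtain ⟨s, hs, hmin⟩ := exists_measurable_argmin (fun k t ↦ ∫⁻ y, c k y ∂ρ.condKernel t)
    (fun t ↦ by
      refine continuous_iff_continuousAt.mpr fun k ↦ ?_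
      refine tendsto_lintegral_filter_of_dominated_convergence (fun _ ↦ 1)
        (Filter.Eventually.of_forall fun k ↦ hm.comp measurable_prodMk_left)
        (Filter.Eventually.of_forall fun k ↦ Filter.Eventually.of_forall fun y ↦ hb k y)
        (by simp) (Filter.Eventually.of_forall fun y ↦ (hc y).continuousAt))
    (fun k ↦ (hm.comp measurable_prodMk_left).lintegral_kernel)
  have key : ∀ s' : T → K, Measurable s' → ∫⁻ x, c (s' (q x)) (u x) ∂μ =
      ∫⁻ t, ∫⁻ y, c (s' t) y ∂ρ.condKernel t ∂ρ.fst := by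
    intro s' hs'
    have hmeas : Measurable fun p : T × Y ↦ c (s' p.1) p.2 :=
      hm.comp ((hs'.comp measurable_fst).prodMk measurable_snd)
    rw [Measure.lintegral_condKernel hmeas, lintegral_map hmeas (hq.prodMk hu)]
  refine ⟨s, hs, fun s' hs' ↦ ?_⟩
  rw [key s hs, key s' hs']
  exact lintegral_mono fun t ↦ hmin t (s' t)

/-- The residual energy of a square-integrable vector field has a minimizer among the
contractive frames that are functions of `q`. -/
lemma exists_measurable_minimizer_residual {X T : Type*} [MeasurableSpace X]
    [MeasurableSpace T] [MeasurableSpace.CountableOrCountablyGenerated T E]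
    {μ : Measure X} {q : X → T} (hq : Measurable q) {g : X → E}
    (hg : Measurable g) (hg2 : ∫⁻ x, ‖g x‖ₑ ^ 2 ∂μ ≠ ∞) :
    ∃ v : T → contractiveFrames E ℓ, Measurable v ∧
      ∀ w : T → contractiveFrames E ℓ, Measurable w →
        ∫⁻ x, ‖frameResidual (v (q x)).1 (g x)‖ₑ ^ 2 ∂μ ≤
          ∫⁻ x, ‖frameResidual (w (q x)).1 (g x)‖ₑ ^ 2 ∂μ := by
  have : ProperSpace E := FiniteDimensional.proper ℂ E
  -- `μ` may be infinite and the residual energy unbounded. As the residual is homogeneous, the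
  -- factor ‖g‖² moves into the finite measure `ν`, leaving the normalized field `u`. The truncation
  -- at 1 below is inactive on `u`, by contractivity.
  set u : X → E := fun x ↦ ((‖g x‖⁻¹ : ℝ) : ℂ) • g x with hu
  have hum : Measurable u := by fun_prop
  have hgu : ∀ x, g x = (‖g x‖ : ℂ) • u x := by
    intro x
    rcases eq_or_ne (g x) 0 with h | h
    · simp [hu, h]
    · simp [hu, smul_smul, h]
  have hu1 : ∀ x, ‖u x‖ ≤ 1 := fun x ↦ by
    simp only [hu, norm_smul, Complex.norm_real, norm_inv, norm_norm]
    exact inv_mul_le_one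
  set ν : Measure X := μ.withDensity fun x ↦ ‖g x‖ₑ ^ 2
  have hν : IsFiniteMeasure ν := isFiniteMeasure_withDensity hg2
  have hcm : Measurable fun p : contractiveFrames E ℓ × E ↦
      min (‖frameResidual p.1.1 p.2‖ₑ ^ 2) 1 :=
    ((Measurable.frameResidual (measurable_subtype_coe.comp measurable_fst)
      measurable_snd).enorm.pow_const 2).min measurable_const
  obtain ⟨v, hv, hmin⟩ := exists_measurable_minimizer_lintegral (μ := ν) hq hum
    (fun (v : contractiveFrames E ℓ) y ↦ min (‖frameResidual v.1 y‖ₑ ^ 2) 1)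
    (fun y ↦ by
      have : Continuous fun v : contractiveFrames E ℓ ↦ ‖frameResidual (v : Fin ℓ → E) y‖ₑ := by
        fun_prop
      exact ((ENNReal.continuous_pow 2).comp this).min continuous_const) hcm
    (fun _ _ ↦ min_le_right _ _)
  have key : ∀ w : T → contractiveFrames E ℓ, Measurable w →
      ∫⁻ x, ‖frameResidual (w (q x)).1 (g x)‖ₑ ^ 2 ∂μ =
        ∫⁻ x, min (‖frameResidual (w (q x)).1 (u x)‖ₑ ^ 2) 1 ∂ν := by
    intro w hw
    have h2 : Measurable fun x ↦ min (‖frameResidual (w (q x)).1 (u x)‖ₑ ^ 2) 1 :=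
      ((Measurable.frameResidual (measurable_subtype_coe.comp (hw.comp hq))
        hum).enorm.pow_const 2).min measurable_const
    rw [lintegral_withDensity_eq_lintegral_mul _ (by fun_prop) h2]
    refine lintegral_congr fun x ↦ ?_
    have h1 : ‖frameResidual (w (q x)).1 (u x)‖ₑ ^ 2 ≤ 1 := by
      refine pow_le_one₀ zero_le ?_
      rw [← ofReal_norm]
      exact ENNReal.ofReal_le_one.mpr (((w (q x)).2.2 (u x)).trans (hu1 x))
    have h3 : ‖((‖g x‖ : ℝ) : ℂ)‖ₑ = ‖g x‖ₑ := by
      rw [← ofReal_norm, ← ofReal_norm, Complex.norm_real, norm_norm]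
    have h4 : ‖frameResidual (w (q x)).1 (g x)‖ₑ =
        ‖g x‖ₑ * ‖frameResidual (w (q x)).1 (u x)‖ₑ := by
      conv_lhs => rw [hgu x, frameResidual_smul, enorm_smul, h3]
    rw [Pi.mul_apply, min_eq_left h1, h4, mul_pow]
  refine ⟨v, hv, fun w hw ↦ ?_⟩
  rw [key v hv, key w hw]
  exact hmin w hw

end Selection

/-! ### Translations as modulations on the Fourier side -/

namespace ShiftInvariant

variable {d : ℕ}

lemma translate_coeFn (v : Rd d) (f : L2 d) : ⇑(translate v f) =ᵐ[volume] fun x ↦ f (x - v) :=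
  Lp.coeFn_compMeasurePreserving f _

lemma isometry_translate (v : Rd d) : Isometry (translate v : L2 d → L2 d) :=
  Lp.isometry_compMeasurePreserving _

lemma translate_translate (v w : Rd d) (f : L2 d) :
    translate v (translate w f) = translate (v + w) f := by
  refine Lp.ext ?_
  filter_upwards [translate_coeFn v (translate w f), translate_coeFn (v + w) f,
    (measurePreserving_sub_right volume v).quasiMeasurePreserving.ae (translate_coeFn w f)]
    with x h1 h2 h3
  rw [h1, h2, h3, sub_sub]

/-- Translation by `v` as a continuous linear map. -/
noncomputable def translateL (v : Rd d) : L2 d →L[ℂ] L2 d where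
  toLinearMap := Lp.compMeasurePreservingₗ ℂ _ (measurePreserving_sub_right volume v)
  cont := (isometry_translate v).continuous

@[simp]
lemma translateL_apply (v : Rd d) (f : L2 d) : translateL v f = translate v f := rfl

/-- The character `ω ↦ exp (-2πi ⟪v, ω⟫)`. -/
noncomputable def character (v ω : Rd d) : ℂ := Real.fourierChar (-inner ℝ v ω)

lemma continuous_character (v : Rd d) : Continuous (character v) := by
  unfold character
  fun_prop

lemma norm_character (v ω : Rd d) : ‖character v ω‖ = 1 := Circle.norm_coe _

lemma memLp_mul_of_bounded {a : Rd d → ℂ} (ha : Measurable a) {C : ℝ} (hC : ∀ x, ‖a x‖ ≤ C)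
    (f : L2 d) : MemLp (fun ω ↦ a ω * f ω) 2 volume :=
  (Lp.memLp f).of_le_mul (c := C)
    (ha.aestronglyMeasurable.mul (Lp.aestronglyMeasurable f)) <| .of_forall fun x ↦ by
      rw [norm_mul]
      exact mul_le_mul_of_nonneg_right (hC x) (norm_nonneg _)

/-- Multiplication of an `L²` function by a bounded measurable function, extended by zero. -/
noncomputable def mulBdd (a : Rd d → ℂ) (ha : Measurable a) {C : ℝ} (hC : ∀ x, ‖a x‖ ≤ C)
    (f : L2 d) : L2 d := (memLp_mul_of_bounded ha hC f).toLp

lemma norm_mulBdd_sub_le {a : Rd d → ℂ} (ha : Measurable a) {C : ℝ} (hC : ∀ x, ‖a x‖ ≤ C)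
    (f g : L2 d) : ‖mulBdd a ha hC f - mulBdd a ha hC g‖ ≤ C * ‖f - g‖ := by
  refine Lp.norm_le_mul_norm_of_ae_le_mul ?_
  filter_upwards [(memLp_mul_of_bounded ha hC f).coeFn_toLp,
    (memLp_mul_of_bounded ha hC g).coeFn_toLp, Lp.coeFn_sub f g,
    Lp.coeFn_sub (mulBdd a ha hC f) (mulBdd a ha hC g)] with x h1 h2 h3 h4
  rw [h4, h3, Pi.sub_apply, Pi.sub_apply, mulBdd, mulBdd, h1, h2, ← mul_sub, norm_mul]
  exact mul_le_mul_of_nonneg_right (hC x) (norm_nonneg _)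

lemma continuous_mulBdd {a : Rd d → ℂ} (ha : Measurable a) {C : ℝ} (hC : ∀ x, ‖a x‖ ≤ C) :
    Continuous (mulBdd a ha hC) :=
  (LipschitzWith.of_dist_le' fun f g ↦ by
    simpa only [dist_eq_norm] using norm_mulBdd_sub_le ha hC f g).continuous

/-- The Fourier transform intertwines translation and modulation. -/
lemma fourier_translate (v : Rd d) (f : L2 d) :
    ⇑(𝓕 (translate v f) : L2 d) =ᵐ[volume] fun ω ↦ character v ω * (𝓕 f : L2 d) ω := by
  have hC : ∀ ω, ‖character v ω‖ ≤ 1 := fun ω ↦ (norm_character v ω).le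
  have hm := (continuous_character v).measurable
  suffices h : (𝓕 (translate v f) : L2 d) = mulBdd (character v) hm hC (𝓕 f : L2 d) by
    rw [h]
    exact (memLp_mul_of_bounded hm hC _).coeFn_toLp
  have hF : Continuous fun f : L2 d ↦ (𝓕 f : L2 d) := (Lp.fourierTransformₗᵢ (Rd d) ℂ).continuous
  -- Both sides are continuous in `f`, so the classical formula for Schwartz functions suffices.
  refine (SchwartzMap.denseRange_toLpCLM (p := 2) (μ := (volume : Measure (Rd d))) (F := ℂ)
    ENNReal.ofNat_ne_top).induction_on
    (p := fun f ↦ (𝓕 (translate v f) : L2 d) = mulBdd (character v) hm hC (𝓕 f : L2 d)) f ?_ ?_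
  · exact isClosed_eq (hF.comp (isometry_translate v).continuous)
      ((continuous_mulBdd hm hC).comp hF)
  intro f
  rw [SchwartzMap.toLpCLM_apply]
  have h1 : translate v (f.toLp 2) = (f.compSubConstCLM ℂ v).toLp 2 := by
    refine Lp.ext ?_
    filter_upwards [translate_coeFn v (f.toLp 2), (f.compSubConstCLM ℂ v).coeFn_toLp 2,
      (measurePreserving_sub_right volume v).quasiMeasurePreserving.ae (f.coeFn_toLp 2 volume)]
      with x h1 h2 h3
    rw [h1, h2, h3]
    rfl
  rw [h1, SchwartzMap.toLp_fourier_eq, SchwartzMap.toLp_fourier_eq]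
  refine Lp.ext ?_
  filter_upwards [(𝓕 (f.compSubConstCLM ℂ v)).coeFn_toLp 2,
    (memLp_mul_of_bounded hm hC ((𝓕 f).toLp 2)).coeFn_toLp, (𝓕 f).coeFn_toLp 2] with ω h1 h2 h3
  rw [h1, mulBdd, h2, h3, SchwartzMap.fourier_coe, SchwartzMap.fourier_coe]
  have := congrFun (VectorFourier.fourierIntegral_comp_add_right Real.fourierChar volume
    (innerₗ (Rd d)) f (-v)) ω
  simp only [character]
  convert this using 1
  · rfl
  · simp [Circle.smul_def]
    rfl

end ShiftInvariant

lemma eLpNorm_two_sq {α G : Type*} [MeasurableSpace α] [NormedAddCommGroup G] (μ : Measure α)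
    (f : α → G) : eLpNorm f 2 μ ^ 2 = ∫⁻ x, ‖f x‖ₑ ^ 2 ∂μ := by
  have := eLpNorm_nnreal_pow_eq_lintegral (f := f) (μ := μ) (p := 2) (by norm_num)
  simpa only [ENNReal.coe_ofNat, NNReal.coe_ofNat, ENNReal.rpow_ofNat] using this

/-! ### Multipliers of the torus variable -/

namespace ShiftInvariant

variable {d : ℕ} {ι : Type*} [Fintype ι]

/-- The map `ω ↦ (-⟪b j, ω⟫ mod 1)_j` to the torus. -/
noncomputable def torusMap (b : ι → Rd d) (ω : Rd d) : UnitAddTorus ι :=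
  fun j ↦ ((-inner ℝ (b j) ω : ℝ) : UnitAddCircle)

lemma measurable_torusMap {ι : Type*} (b : ι → Rd d) : Measurable (torusMap b) := by
  refine measurable_pi_lambda _ fun j ↦ ?_
  exact AddCircle.measurable_mk'.comp (by fun_prop)

/-- The minus sign in `torusMap` is chosen so that monomials pull back to characters without a
change of sign. -/
lemma mFourier_torusMap (b : ι → Rd d) (n : ι → ℤ) (ω : Rd d) :
    UnitAddTorus.mFourier n (torusMap b ω) = character (∑ j, n j • b j) ω := by
  simp only [UnitAddTorus.mFourier, torusMap, ContinuousMap.coe_mk, fourier_coe_apply, character,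
    Real.fourierChar_apply, ← Complex.exp_sum]
  congr 1
  simp only [sum_inner, ← Finset.sum_neg_distrib, Complex.ofReal_sum, Finset.mul_sum,
    Finset.sum_mul]
  refine Finset.sum_congr rfl fun j _ ↦ ?_
  rw [← Int.cast_smul_eq_zsmul ℝ, real_inner_smul_left]
  push_cast
  ring

/-- Multiplication on the Fourier side by continuous functions of the torus variable. -/
noncomputable def multiplierL (b : ι → Rd d) (f : L2 d) : C(UnitAddTorus ι, ℂ) →L[ℂ] L2 d :=
  LinearMap.mkContinuous
    { toFun := fun c ↦ (Lp.fourierTransformₗᵢ (Rd d) ℂ).symm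
        (mulBdd (fun ω ↦ c (torusMap b ω)) (c.continuous.measurable.comp (measurable_torusMap b))
          (fun _ ↦ c.norm_coe_le_norm _) (𝓕 f : L2 d))
      map_add' := fun c c' ↦ by
        rw [← map_add]
        congr 1
        refine Lp.ext ?_
        refine (MemLp.coeFn_toLp _).trans ?_
        refine Filter.EventuallyEq.trans ?_ (Lp.coeFn_add _ _).symm
        filter_upwards [MemLp.coeFn_toLp (memLp_mul_of_bounded
          (c.continuous.measurable.comp (measurable_torusMap b)) (fun _ ↦ c.norm_coe_le_norm _)
            (𝓕 f : L2 d)), MemLp.coeFn_toLp (memLp_mul_of_bounded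
          (c'.continuous.measurable.comp (measurable_torusMap b)) (fun _ ↦ c'.norm_coe_le_norm _)
            (𝓕 f : L2 d))] with ω h1 h2
        simp only [mulBdd, Pi.add_apply]
        erw [h1, h2]
        simp [add_mul]
      map_smul' := fun r c ↦ by
        rw [RingHom.id_apply, ← map_smul]
        congr 1
        refine Lp.ext ?_
        refine (MemLp.coeFn_toLp _).trans ?_
        refine Filter.EventuallyEq.trans ?_ (Lp.coeFn_smul _ _).symm
        filter_upwards [MemLp.coeFn_toLp (memLp_mul_of_bounded
          (c.continuous.measurable.comp (measurable_torusMap b)) (fun _ ↦ c.norm_coe_le_norm _)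
            (𝓕 f : L2 d))] with ω h1
        simp only [mulBdd, Pi.smul_apply]
        erw [h1]
        simp [mul_assoc] } ‖f‖ fun c ↦ by
    simp only [LinearMap.coe_mk, AddHom.coe_mk, LinearIsometryEquiv.norm_map]
    rw [mul_comm, ← Lp.norm_fourier_eq f]
    refine Lp.norm_le_mul_norm_of_ae_le_mul ?_
    filter_upwards [MemLp.coeFn_toLp (memLp_mul_of_bounded
      (c.continuous.measurable.comp (measurable_torusMap b)) (fun _ ↦ c.norm_coe_le_norm _)
        (𝓕 f : L2 d))] with ω h1
    erw [h1]
    rw [norm_mul]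
    exact mul_le_mul_of_nonneg_right (c.norm_coe_le_norm _) (norm_nonneg _)

lemma fourier_multiplierL (b : ι → Rd d) (f : L2 d) (c : C(UnitAddTorus ι, ℂ)) :
    ⇑(𝓕 (multiplierL b f c) : L2 d) =ᵐ[volume]
      fun ω ↦ c (torusMap b ω) * (𝓕 f : L2 d) ω := by
  have : (𝓕 (multiplierL b f c) : L2 d) = mulBdd (fun ω ↦ c (torusMap b ω))
      (c.continuous.measurable.comp (measurable_torusMap b)) (fun _ ↦ c.norm_coe_le_norm _)
      (𝓕 f : L2 d) := (Lp.fourierTransformₗᵢ (Rd d) ℂ).apply_symm_apply _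
  rw [this]
  exact MemLp.coeFn_toLp _

lemma fourier_injective : Function.Injective fun f : L2 d ↦ (𝓕 f : L2 d) :=
  (Lp.fourierTransformₗᵢ (Rd d) ℂ).injective

lemma fourier_sub (f g : L2 d) : (𝓕 (f - g) : L2 d) = 𝓕 f - 𝓕 g :=
  (Lp.fourierTransformₗᵢ (Rd d) ℂ).map_sub f g

/-- Monomials act as lattice translations. Trigonometric polynomials are dense in the continuous
functions, and `S` is closed. -/
lemma multiplierL_mem {Λ : Submodule ℤ (Rd d)} {b : ι → Rd d} (hb : ∀ j, b j ∈ Λ)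
    {S : ClosedSubmodule ℂ (L2 d)} {f : L2 d} (hf : ∀ v ∈ Λ, translate v f ∈ S)
    (c : C(UnitAddTorus ι, ℂ)) : multiplierL b f c ∈ S := by
  have hle : Submodule.span ℂ (Set.range (UnitAddTorus.mFourier (d := ι))) ≤
      S.toSubmodule.comap (multiplierL b f).toLinearMap := by
    rw [Submodule.span_le]
    rintro _ ⟨n, rfl⟩
    have : multiplierL b f (UnitAddTorus.mFourier n) = translate (∑ j, n j • b j) f := by
      refine fourier_injective (Lp.ext ?_)
      filter_upwards [fourier_multiplierL b f (UnitAddTorus.mFourier n),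
        fourier_translate (∑ j, n j • b j) f] with ω h1 h2
      rw [h1, h2, mFourier_torusMap]
    change multiplierL b f (UnitAddTorus.mFourier n) ∈ S
    rw [this]
    exact hf _ (Λ.sum_mem fun j _ ↦ Λ.smul_mem _ (hb j))
  have hcl : IsClosed (S.toSubmodule.comap (multiplierL b f).toLinearMap :
      Set C(UnitAddTorus ι, ℂ)) :=
    S.isClosed.preimage (multiplierL b f).continuous
  have := (Submodule.topologicalClosure_minimal _ hle hcl)
  rw [UnitAddTorus.span_mFourier_closure_eq_top] at this
  exact this (Submodule.mem_top (x := c))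

/-- Bounded measurable multipliers of the torus variable preserve shift-invariant spaces. -/
lemma mem_of_fourier_eq_mul {Λ : Submodule ℤ (Rd d)} {b : ι → Rd d} (hb : ∀ j, b j ∈ Λ)
    {S : ClosedSubmodule ℂ (L2 d)} {f : L2 d} (hf : ∀ v ∈ Λ, translate v f ∈ S)
    {a : UnitAddTorus ι → ℂ} (ha : Measurable a) {C : ℝ} (hC : ∀ x, ‖a x‖ ≤ C) {h : L2 d}
    (hh : ⇑(𝓕 h : L2 d) =ᵐ[volume] fun ω ↦ a (torusMap b ω) * (𝓕 f : L2 d) ω) : h ∈ S := by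
  have hq := measurable_torusMap b
  set F : L2 d := 𝓕 f
  have hFm : Measurable F := (Lp.stronglyMeasurable F).measurable
  have hfin : IsFiniteMeasure ((volume : Measure (Rd d)).withDensity fun ω ↦ ‖F ω‖ₑ ^ 2) := by
    refine isFiniteMeasure_withDensity ?_
    rw [← eLpNorm_two_sq]
    exact ENNReal.pow_ne_top (Lp.eLpNorm_ne_top F)
  -- With `ν` the image of |f̂|² dω, Plancherel identifies the distance from `h` to a continuous
  -- multiple of `f` with an L²(ν) distance on the torus, where continuous functions are dense.
  set ν : Measure (UnitAddTorus ι) :=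
    ((volume : Measure (Rd d)).withDensity fun ω ↦ ‖F ω‖ₑ ^ 2).map (torusMap b)
  have hν : IsFiniteMeasure ν := Measure.isFiniteMeasure_map _ _
  have key : ∀ c : C(UnitAddTorus ι, ℂ), ‖h - multiplierL b f c‖ₑ = eLpNorm (a - ⇑c) 2 ν := by
    intro c
    have h1 : ‖h - multiplierL b f c‖ₑ = ‖(𝓕 (h - multiplierL b f c) : L2 d)‖ₑ := by
      rw [← ofReal_norm, ← ofReal_norm, Lp.norm_fourier_eq]
    rw [h1, Lp.enorm_def]
    refine (ENNReal.pow_right_strictMono two_ne_zero).injective ?_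
    rw [eLpNorm_two_sq, eLpNorm_two_sq, lintegral_map ?_ hq,
      lintegral_withDensity_eq_lintegral_mul _ (by fun_prop) ?_]
    · refine lintegral_congr_ae ?_
      filter_upwards [hh, fourier_multiplierL b f c, Lp.coeFn_sub (𝓕 h : L2 d)
        (𝓕 (multiplierL b f c) : L2 d)] with ω h2 h3 h4
      rw [fourier_sub, h4, Pi.sub_apply, h2, h3, ← sub_mul, enorm_mul, mul_pow, mul_comm]
      rfl
    · exact (((ha.sub c.continuous.measurable).enorm.pow_const 2).comp hq)
    · exact ((ha.sub c.continuous.measurable).enorm.pow_const 2)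
  have haL : MemLp a 2 ν := MemLp.of_bound ha.aestronglyMeasurable C (.of_forall hC)
  change h ∈ (S : Set (L2 d))
  rw [← S.isClosed.closure_eq, EMetric.mem_closure_iff]
  intro ε' hε'
  -- The cap keeps ε finite, so that ε/2 < ε.
  set ε := min ε' 1
  have hε : 0 < ε := lt_min hε' one_pos
  have hεt : ε ≠ ∞ := ne_top_of_le_ne_top ENNReal.one_ne_top (min_le_right _ _)
  obtain ⟨c, hc, -⟩ := haL.exists_boundedContinuous_eLpNorm_sub_le ENNReal.ofNat_ne_top
    (ENNReal.half_pos hε.ne').ne'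
  refine ⟨multiplierL b f c.toContinuousMap, multiplierL_mem hb hf _, ?_⟩
  rw [edist_eq_enorm_sub, key]
  exact (hc.trans_lt (ENNReal.half_lt_self hε.ne' hεt)).trans_le (min_le_left _ _)

end ShiftInvariant

/-! ### Shift-invariant spaces, projections and errors -/

namespace ShiftInvariant

variable {d m ℓ : ℕ} {Λ : Submodule ℤ (Rd d)}

lemma translate_mem_shiftSpan {Φ : Set (L2 d)} {v : Rd d} (hv : v ∈ Λ) {φ : L2 d} (hφ : φ ∈ Φ) :
    translate v φ ∈ shiftSpan Λ Φ :=
  subset_closure (Submodule.subset_span ⟨v, hv, φ, hφ, rfl⟩)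

lemma shiftSpan_le {Φ : Set (L2 d)} {S : ClosedSubmodule ℂ (L2 d)}
    (h : ∀ v ∈ Λ, ∀ φ ∈ Φ, translate v φ ∈ S) : shiftSpan Λ Φ ≤ S := by
  rw [shiftSpan, Submodule.closure_le, Submodule.span_le]
  rintro _ ⟨v, hv, φ, hφ, rfl⟩
  exact h v hv φ hφ

lemma isShiftInvariant_shiftSpan (Φ : Set (L2 d)) : IsShiftInvariant Λ (shiftSpan Λ Φ) := by
  intro v hv f hf
  have h : shiftSpan Λ Φ ≤ (shiftSpan Λ Φ).comap (translateL v) := by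
    refine shiftSpan_le fun w hw φ hφ ↦ ?_
    change translate v (translate w φ) ∈ shiftSpan Λ Φ
    rw [translate_translate]
    exact translate_mem_shiftSpan (Λ.add_mem hv hw) hφ
  exact h hf

lemma shiftSpan_range_mem_sisClass (Φ : Fin ℓ → L2 d) :
    shiftSpan Λ (Set.range Φ) ∈ sisClass Λ ℓ := by
  refine ⟨isShiftInvariant_shiftSpan _, (iInf_le _ ⟨Set.range Φ, rfl⟩).trans ?_⟩
  rw [← Set.image_univ]
  refine (Set.encard_image_le _ _).trans ?_
  simp

/-- An infimum in `ℕ∞` below ℓ + 1 is witnessed by a set with at most ℓ elements; zeros pad it to a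
family indexed by `Fin ℓ` without changing the span. -/
lemma exists_shiftSpan_range_eq {S : ClosedSubmodule ℂ (L2 d)} (hS : S ∈ sisClass Λ ℓ) :
    ∃ Ψ : Fin ℓ → L2 d, shiftSpan Λ (Set.range Ψ) = S := by
  classical
  have h1 : length Λ S < (ℓ : ℕ∞) + 1 := (ENat.lt_add_one_iff (ENat.natCast_ne_top ℓ)).mpr hS.2
  obtain ⟨⟨Φ, rfl⟩, hΦ⟩ := iInf_lt_iff.mp h1
  have h2 : Φ.encard ≤ ℓ := (ENat.lt_add_one_iff (ENat.natCast_ne_top ℓ)).mp hΦ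
  obtain ⟨hfin, hcard⟩ := Set.encard_le_coe_iff_finite_ncard_le.mp h2
  have := hfin.fintype
  have hc : Fintype.card Φ ≤ ℓ := by rwa [← Nat.card_eq_fintype_card]
  set e := Fintype.equivFin Φ
  set Ψ : Fin ℓ → L2 d :=
    fun k ↦ if h : k.1 < Fintype.card Φ then (e.symm ⟨k, h⟩ : L2 d) else 0 with hΨ
  refine ⟨Ψ, le_antisymm (shiftSpan_le ?_) (shiftSpan_le ?_)⟩
  · rintro v hv _ ⟨k, rfl⟩
    simp only [hΨ]
    split_ifs with h
    · exact translate_mem_shiftSpan hv (e.symm ⟨k, h⟩).2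
    · rw [← translateL_apply, map_zero]
      exact zero_mem _
  · intro v hv φ hφ
    refine translate_mem_shiftSpan hv ⟨Fin.castLE hc (e ⟨φ, hφ⟩), ?_⟩
    have h : (e ⟨φ, hφ⟩).1 < Fintype.card Φ := (e ⟨φ, hφ⟩).2
    simp only [hΨ, Fin.val_castLE, dif_pos h, Fin.eta, Equiv.symm_apply_apply]

lemma mem_paleyWiener {Ω : Set (Rd d)} {f : L2 d} :
    f ∈ paleyWiener Ω ↔ ∀ᵐ ω : Rd d, ω ∉ Ω → (𝓕 f : L2 d) ω = 0 := Iff.rfl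

lemma translate_mem_paleyWiener {Ω : Set (Rd d)} (v : Rd d) {f : L2 d}
    (hf : f ∈ paleyWiener Ω) : translate v f ∈ paleyWiener Ω := by
  rw [mem_paleyWiener] at hf ⊢
  filter_upwards [hf, fourier_translate v f] with ω h1 h2 hω
  rw [h2, h1 hω, mul_zero]

lemma proj_mem (S : ClosedSubmodule ℂ (L2 d)) (f : L2 d) : proj S f ∈ S :=
  S.toSubmodule.starProjection_apply_mem f

lemma norm_sub_proj_le {S : ClosedSubmodule ℂ (L2 d)} (f : L2 d) {h : L2 d} (hh : h ∈ S) :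
    ‖f - proj S f‖ ≤ ‖f - h‖ := by
  rw [proj, Submodule.starProjection_minimal]
  exact ciInf_le ⟨0, Set.forall_mem_range.2 fun _ ↦ norm_nonneg _⟩ (⟨h, hh⟩ : S.toSubmodule)

/-- Pythagoras: the error for data `F` splits off the distance of the data to a larger space. -/
lemma error_eq_add_error_proj (F : Fin m → L2 d) {S P : ClosedSubmodule ℂ (L2 d)} (h : S ≤ P) :
    error F S = error F P + error (fun i ↦ proj P (F i)) S := by
  simp only [error, ← Finset.sum_add_distrib]
  refine Finset.sum_congr rfl fun i _ ↦ ?_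
  have h1 : proj S (proj P (F i)) = proj S (F i) :=
    congrArg (fun T : L2 d →L[ℂ] L2 d ↦ T (F i))
      (Submodule.starProjection_comp_starProjection_of_le (U := S.toSubmodule)
        (V := P.toSubmodule) h)
  have h2 : F i - proj S (F i) = (F i - proj P (F i)) + (proj P (F i) - proj S (F i)) := by abel
  rw [h1, h2, sq, sq, sq]
  refine norm_add_sq_eq_norm_sq_add_norm_sq_of_inner_eq_zero (𝕜 := ℂ) _ _ ?_
  exact P.toSubmodule.starProjection_inner_eq_zero _ _
    (P.toSubmodule.sub_mem (proj_mem P _) (h (proj_mem S _)))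

/-! ### The optimal error as a residual energy -/

/-- The vector of Fourier transforms of a finite family. -/
noncomputable def fourierVec (f : Fin m → L2 d) (ω : Rd d) : EuclideanSpace ℂ (Fin m) :=
  WithLp.toLp 2 fun i ↦ (𝓕 (f i) : L2 d) ω

lemma measurable_fourierVec (f : Fin m → L2 d) : Measurable (fourierVec f) :=
  (WithLp.measurable_toLp 2 _).comp
    (measurable_pi_lambda _ fun i ↦ (Lp.stronglyMeasurable (𝓕 (f i) : L2 d)).measurable)

lemma enorm_sq_eq_sum {ι : Type*} [Fintype ι] (x : EuclideanSpace ℂ ι) :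
    ‖x‖ₑ ^ 2 = ∑ i, ‖x i‖ₑ ^ 2 := by
  rw [← ofReal_norm, ← ENNReal.ofReal_pow (norm_nonneg _), EuclideanSpace.norm_sq_eq,
    ENNReal.ofReal_sum_of_nonneg fun _ _ ↦ sq_nonneg _]
  refine Finset.sum_congr rfl fun i _ ↦ ?_
  rw [← ofReal_norm, ENNReal.ofReal_pow (norm_nonneg _)]

lemma lintegral_fourierVec (f : Fin m → L2 d) :
    ∫⁻ ω, ‖fourierVec f ω‖ₑ ^ 2 = ENNReal.ofReal (∑ i, ‖f i‖ ^ 2) := by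
  simp_rw [enorm_sq_eq_sum, fourierVec]
  rw [lintegral_finsetSum _ fun i _ ↦
    (Lp.stronglyMeasurable (𝓕 (f i) : L2 d)).measurable.enorm.pow_const 2,
    ENNReal.ofReal_sum_of_nonneg fun _ _ ↦ sq_nonneg _]
  refine Finset.sum_congr rfl fun i _ ↦ ?_
  rw [← eLpNorm_two_sq, ← Lp.enorm_def, ENNReal.ofReal_pow (norm_nonneg _),
    ← Lp.norm_fourier_eq (f i), ofReal_norm]

lemma fourierVec_sub (f g : Fin m → L2 d) :
    fourierVec (fun i ↦ f i - g i) =ᵐ[volume] fun ω ↦ fourierVec f ω - fourierVec g ω := by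
  filter_upwards [ae_all_iff.mpr fun i ↦ Lp.coeFn_sub (𝓕 (f i) : L2 d) (𝓕 (g i) : L2 d)] with ω h
  ext i
  simp only [fourierVec, fourier_sub, PiLp.sub_apply]
  exact h i

/-- Elements of the span of the translates have Fourier transforms with coefficients that are
measurable functions of the torus variable. -/
lemma exists_fourier_eq_sum {ι : Type*} [Fintype ι] {b : ι → Rd d}
    (hb : Submodule.span ℤ (Set.range b) = Λ) (Ψ : Fin ℓ → L2 d) {h : L2 d}
    (hh : h ∈ Submodule.span ℂ {g : L2 d | ∃ v ∈ Λ, ∃ φ ∈ Set.range Ψ, g = translate v φ}) :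
    ∃ a : Fin ℓ → UnitAddTorus ι → ℂ, (∀ k, Measurable (a k)) ∧
      ⇑(𝓕 h : L2 d) =ᵐ[volume] fun ω ↦ ∑ k, a k (torusMap b ω) * (𝓕 (Ψ k) : L2 d) ω := by
  classical
  induction hh using Submodule.span_induction with
  | mem h hh =>
    obtain ⟨v, hv, _, ⟨k, rfl⟩, rfl⟩ := hh
    rw [← hb, Submodule.mem_span_range_iff_exists_fun] at hv
    obtain ⟨n, rfl⟩ := hv
    refine ⟨fun j x ↦ if j = k then UnitAddTorus.mFourier n x else 0, fun j ↦ ?_, ?_⟩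
    · by_cases hj : j = k
      · simp only [hj, if_true]
        exact (UnitAddTorus.mFourier n).continuous.measurable
      · simp only [hj, if_false]
        exact measurable_const
    · filter_upwards [fourier_translate (∑ j, n j • b j) (Ψ k)] with ω h1
      rw [h1, ← mFourier_torusMap]
      simp
  | zero =>
    refine ⟨fun _ _ ↦ 0, fun _ ↦ measurable_const, ?_⟩
    have h0 : (𝓕 (0 : L2 d) : L2 d) = 0 := (Lp.fourierTransformₗᵢ (Rd d) ℂ).map_zero
    rw [h0]
    exact .of_forall fun ω ↦ by simp
  | add f g _ _ hf hg =>
    obtain ⟨a, ha, ha'⟩ := hf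
    obtain ⟨c, hc, hc'⟩ := hg
    refine ⟨fun k x ↦ a k x + c k x, fun k ↦ (ha k).add (hc k), ?_⟩
    rw [FourierTransform.fourier_add]
    filter_upwards [ha', hc', Lp.coeFn_add (𝓕 f : L2 d) (𝓕 g : L2 d)] with ω h1 h2 h3
    rw [h3, Pi.add_apply, h1, h2, ← Finset.sum_add_distrib]
    simp only [add_mul]
  | smul r f _ hf =>
    obtain ⟨a, ha, ha'⟩ := hf
    refine ⟨fun k x ↦ r * a k x, fun k ↦ (ha k).const_mul r, ?_⟩
    rw [FourierTransform.fourier_smul]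
    filter_upwards [ha', Lp.coeFn_smul r (𝓕 f : L2 d)] with ω h1 h2
    rw [h2, Pi.smul_apply, h1, smul_eq_mul, Finset.mul_sum]
    simp only [mul_assoc]

/-- The minimal residual energy bounds the error of every space with `ℓ` generators from below. -/
lemma lintegral_frameResidual_le_error {ι : Type*} [Fintype ι] {b : ι → Rd d}
    (hb : Submodule.span ℤ (Set.range b) = Λ) (g : Fin m → L2 d) {J : ℝ≥0∞}
    (hJ : ∀ w : UnitAddTorus ι → contractiveFrames (EuclideanSpace ℂ (Fin m)) ℓ, Measurable w →
      J ≤ ∫⁻ ω, ‖frameResidual (w (torusMap b ω)).1 (fourierVec g ω)‖ₑ ^ 2)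
    (Ψ : Fin ℓ → L2 d) : J ≤ ENNReal.ofReal (error g (shiftSpan Λ (Set.range Ψ))) := by
  set W := Submodule.span ℂ {g : L2 d | ∃ v ∈ Λ, ∃ φ ∈ Set.range Ψ, g = translate v φ} with hW
  have hspan : ∀ h : Fin m → L2 d, (∀ i, h i ∈ W) → J ≤ ENNReal.ofReal (∑ i, ‖g i - h i‖ ^ 2) := by
    intro h hh
    choose a ha ha' using fun i ↦ exists_fourier_eq_sum hb Ψ (hh i)
    set A : UnitAddTorus ι → Fin ℓ → EuclideanSpace ℂ (Fin m) :=
      fun t k ↦ WithLp.toLp 2 fun i ↦ a i k t with hA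
    have hAm : Measurable A := measurable_pi_lambda _ fun k ↦
      (WithLp.measurable_toLp 2 _).comp (measurable_pi_lambda _ fun i ↦ ha i k)
    -- The transform of `h` is a combination of the vectors `A (q ω) k`. A frame annihilating them
    -- gives `g` and `g - h` the same residual, which contractivity bounds by the norm of ĝ - ĥ.
    obtain ⟨w, hw, hw0⟩ := exists_measurable_residual_eq_zero hAm
    refine (hJ w hw).trans ?_
    rw [← lintegral_fourierVec]
    refine lintegral_mono_ae ?_
    filter_upwards [fourierVec_sub g h, ae_all_iff.mpr ha'] with ω h1 h2
    have h3 : fourierVec h ω = ∑ k, (𝓕 (Ψ k) : L2 d) ω • A (torusMap b ω) k := by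
      ext i
      simp only [fourierVec, hA, WithLp.ofLp_sum, WithLp.ofLp_smul, Finset.sum_apply,
        Pi.smul_apply, smul_eq_mul]
      rw [h2 i]
      exact Finset.sum_congr rfl fun k _ ↦ mul_comm _ _
    have h4 : frameResidual (w (torusMap b ω)).1 (fourierVec g ω) =
        frameResidual (w (torusMap b ω)).1 (fourierVec g ω - fourierVec h ω) := by
      rw [frameResidual_sub, h3, frameResidual_sum]
      simp [frameResidual_smul, hw0]
    rw [h1, h4]
    gcongr
    exact enorm_le_iff_norm_le.mpr ((w (torusMap b ω)).2.2 _)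
  -- No coefficients are needed for elements of the closure: the inequality is a closed condition on
  -- `h`, and the projections of the data are limits of families in `W`.
  have hcl : IsClosed {h : Fin m → L2 d | J ≤ ENNReal.ofReal (∑ i, ‖g i - h i‖ ^ 2)} := by
    refine isClosed_le continuous_const (ENNReal.continuous_ofReal.comp ?_)
    fun_prop
  have hmem : (fun i ↦ proj (shiftSpan Λ (Set.range Ψ)) (g i)) ∈
      closure (Set.univ.pi fun _ : Fin m ↦ (W : Set (L2 d))) := by
    rw [closure_pi_set]
    exact fun i _ ↦ proj_mem (shiftSpan Λ (Set.range Ψ)) (g i)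
  exact closure_minimal (fun h hh ↦ hspan h fun i ↦ hh i (Set.mem_univ i) :
    (Set.univ.pi fun _ : Fin m ↦ (W : Set (L2 d))) ⊆ _) hcl hmem

/-- A measurable contractive frame on the torus yields generators, supported on the Fourier side
where the data are, whose error is at most the residual energy. -/
lemma exists_generators_error_le {ι : Type*} [Fintype ι] {b : ι → Rd d} (hb : ∀ j, b j ∈ Λ)
    (g : Fin m → L2 d) {w : UnitAddTorus ι → contractiveFrames (EuclideanSpace ℂ (Fin m)) ℓ}
    (hw : Measurable w) :
    ∃ Φ : Fin ℓ → L2 d,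
      (∀ k, ∀ᵐ ω, (∀ i, (𝓕 (g i) : L2 d) ω = 0) → (𝓕 (Φ k) : L2 d) ω = 0) ∧
      ENNReal.ofReal (error g (shiftSpan Λ (Set.range Φ))) ≤
        ∫⁻ ω, ‖frameResidual (w (torusMap b ω)).1 (fourierVec g ω)‖ₑ ^ 2 := by
  have hwk : ∀ k, Measurable fun t ↦ (w t).1 k := fun k ↦
    (measurable_pi_apply k).comp (measurable_subtype_coe.comp hw)
  have hwki : ∀ k i, Measurable fun t ↦ (w t).1 k i := fun k i ↦
    (measurable_pi_apply i).comp ((WithLp.measurable_ofLp 2 _).comp (hwk k))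
  have hq := measurable_torusMap b
  have hgL : MemLp (fourierVec g) 2 (volume : Measure (Rd d)) := by
    refine ⟨(measurable_fourierVec g).aestronglyMeasurable, ?_⟩
    have : eLpNorm (fourierVec g) 2 (volume : Measure (Rd d)) ^ 2 < ∞ := by
      rw [eLpNorm_two_sq, lintegral_fourierVec]
      exact ENNReal.ofReal_lt_top
    exact (ENNReal.pow_lt_top_iff.mp this).resolve_right two_ne_zero
  have hφ : ∀ k, MemLp (fun ω ↦ inner ℂ ((w (torusMap b ω)).1 k) (fourierVec g ω)) 2
      (volume : Measure (Rd d)) := by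
    intro k
    refine hgL.mono (Measurable.aestronglyMeasurable ?_) (.of_forall fun ω ↦ ?_)
    · exact ((hwk k).comp hq).inner (measurable_fourierVec g)
    · refine (norm_inner_le_norm _ _).trans ?_
      exact mul_le_of_le_one_left (norm_nonneg _) ((w _).2.1 k)
  -- The generators are the coefficients of the data in the frame. They lie in L² because the frame
  -- vectors have norm at most 1, and they vanish where the data do.
  set Φ : Fin ℓ → L2 d := fun k ↦ 𝓕⁻ ((hφ k).toLp)
  have hΦ : ∀ k, ⇑(𝓕 (Φ k) : L2 d) =ᵐ[volume]
      fun ω ↦ inner ℂ ((w (torusMap b ω)).1 k) (fourierVec g ω) := fun k ↦ by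
    have : (𝓕 (Φ k) : L2 d) = (hφ k).toLp := fourier_fourierInv_eq _
    rw [this]
    exact (hφ k).coeFn_toLp
  refine ⟨Φ, fun k ↦ ?_, ?_⟩
  · filter_upwards [hΦ k] with ω h1 h2
    have h3 : fourierVec g ω = 0 := by
      ext i
      simp [fourierVec, h2 i]
    rw [h1, h3, inner_zero_right]
  have hterm : ∀ k i, ∃ h ∈ shiftSpan Λ (Set.range Φ), ⇑(𝓕 h : L2 d) =ᵐ[volume]
      fun ω ↦ (w (torusMap b ω)).1 k i * (𝓕 (Φ k) : L2 d) ω := by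
    intro k i
    have hC : ∀ t, ‖(w t).1 k i‖ ≤ 1 := fun t ↦ (PiLp.norm_apply_le _ i).trans ((w t).2.1 k)
    have hL := memLp_mul_of_bounded ((hwki k i).comp hq) (fun ω ↦ hC (torusMap b ω))
      (𝓕 (Φ k) : L2 d)
    have hF : ⇑(𝓕 (𝓕⁻ hL.toLp : L2 d) : L2 d) =ᵐ[volume]
        fun ω ↦ (w (torusMap b ω)).1 k i * (𝓕 (Φ k) : L2 d) ω := by
      rw [fourier_fourierInv_eq]
      exact hL.coeFn_toLp
    exact ⟨𝓕⁻ hL.toLp, mem_of_fourier_eq_mul hb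
      (fun v hv ↦ translate_mem_shiftSpan hv (Set.mem_range_self k)) (hwki k i) hC hF, hF⟩
  choose h hh hh' using hterm
  have hsum : ∀ i, ∑ k, h k i ∈ shiftSpan Λ (Set.range Φ) := fun i ↦ sum_mem fun k _ ↦ hh k i
  have hfs : ∀ i, ⇑(𝓕 (∑ k, h k i) : L2 d) =ᵐ[volume] fun ω ↦ ∑ k, (𝓕 (h k i) : L2 d) ω := by
    intro i
    have : (𝓕 (∑ k, h k i) : L2 d) = ∑ k, 𝓕 (h k i) := map_sum (Lp.fourierTransformₗᵢ (Rd d) ℂ) _ _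
    rw [this]
    filter_upwards [Lp.coeFn_finsetSum Finset.univ fun k ↦ (𝓕 (h k i) : L2 d)] with ω h1
    rw [h1, Finset.sum_apply]
  -- The transforms of the competitors `∑ k, h k i` are the coordinates of ∑ ⟪v_k, ĝ⟫ v_k, so their
  -- error is exactly the residual energy.
  calc ENNReal.ofReal (error g (shiftSpan Λ (Set.range Φ)))
      ≤ ENNReal.ofReal (∑ i, ‖g i - ∑ k, h k i‖ ^ 2) := by
        refine ENNReal.ofReal_le_ofReal (Finset.sum_le_sum fun i _ ↦ ?_)
        gcongr
        exact norm_sub_proj_le _ (hsum i)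
    _ = ∫⁻ ω, ‖fourierVec (fun i ↦ g i - ∑ k, h k i) ω‖ₑ ^ 2 := (lintegral_fourierVec _).symm
    _ ≤ _ := le_of_eq <| lintegral_congr_ae <| by
      filter_upwards [fourierVec_sub g fun i ↦ ∑ k, h k i, ae_all_iff.mpr hfs,
        ae_all_iff.mpr fun k ↦ ae_all_iff.mpr (hh' k), ae_all_iff.mpr hΦ] with ω h1 h2 h3 h4
      rw [h1, frameResidual]
      congr 3
      ext i
      simp only [fourierVec, h2 i, h3, h4, WithLp.ofLp_sum, WithLp.ofLp_smul, Finset.sum_apply,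
        Pi.smul_apply, smul_eq_mul]
      exact Finset.sum_congr rfl fun k _ ↦ mul_comm _ _

/-- Every finite family has an optimal shift-invariant space with `ℓ` generators; the generators
can be supported on the Fourier side where the data are. -/
theorem exists_optimal_generators (Λ : Submodule ℤ (Rd d)) [DiscreteTopology Λ] [IsZLattice ℝ Λ]
    (ℓ : ℕ) (g : Fin m → L2 d) :
    ∃ Φ : Fin ℓ → L2 d,
      (∀ k, ∀ᵐ ω, (∀ i, (𝓕 (g i) : L2 d) ω = 0) → (𝓕 (Φ k) : L2 d) ω = 0) ∧
      ∀ Ψ : Fin ℓ → L2 d,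
        error g (shiftSpan Λ (Set.range Φ)) ≤ error g (shiftSpan Λ (Set.range Ψ)) := by
  have hfg : Λ.FG := Module.Finite.iff_fg.mp (ZLattice.module_finite ℝ Λ)
  -- A finite generating family of Λ is enough; linear independence plays no role.
  obtain ⟨n, b, hb⟩ := Submodule.fg_iff_exists_fin_generating_family.mp hfg
  have hbΛ : ∀ j, b j ∈ Λ := fun j ↦ hb ▸ Submodule.subset_span ⟨j, rfl⟩
  obtain ⟨w, hw, hmin⟩ := exists_measurable_minimizer_residual (ℓ := ℓ)
    (μ := (volume : Measure (Rd d))) (measurable_torusMap b) (measurable_fourierVec g)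
    (by rw [lintegral_fourierVec]; exact ENNReal.ofReal_ne_top)
  obtain ⟨Φ, hΦ, hle⟩ := exists_generators_error_le hbΛ g hw
  refine ⟨Φ, hΦ, fun Ψ ↦ ?_⟩
  have := hle.trans (lintegral_frameResidual_le_error hb g hmin Ψ)
  exact (ENNReal.ofReal_le_ofReal_iff (Finset.sum_nonneg fun _ _ ↦ sq_nonneg _)).mp this

end ShiftInvariant

theorem mainTheorem1 {d m ℓ : ℕ}
    (Λ : Submodule ℤ (ShiftInvariant.Rd d)) [DiscreteTopology Λ] [IsZLattice ℝ Λ]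
    (F : Fin m → ShiftInvariant.L2 d) (Ω : Set (ShiftInvariant.Rd d)) :
    ∃ Φ : Fin ℓ → ShiftInvariant.L2 d,
      ShiftInvariant.shiftSpan Λ (Set.range Φ) ∈ ShiftInvariant.sisClassPW Λ ℓ Ω ∧
      (∀ Ψ : Fin ℓ → ShiftInvariant.L2 d, (∀ i, Ψ i ∈ ShiftInvariant.paleyWiener Ω) →
        ShiftInvariant.error F (ShiftInvariant.shiftSpan Λ (Set.range Φ)) ≤
          ShiftInvariant.error F (ShiftInvariant.shiftSpan Λ (Set.range Ψ))) ∧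
      (∀ S ∈ ShiftInvariant.sisClass Λ ℓ,
        ShiftInvariant.error (fun i => ShiftInvariant.proj (ShiftInvariant.paleyWiener Ω) (F i))
            (ShiftInvariant.shiftSpan Λ (Set.range Φ)) ≤
          ShiftInvariant.error (fun i => ShiftInvariant.proj (ShiftInvariant.paleyWiener Ω) (F i))
            S) := by
  open ShiftInvariant in
  obtain ⟨Φ, hΦ, hopt⟩ := exists_optimal_generators Λ ℓ fun i ↦ proj (paleyWiener Ω) (F i)
  have hle : ∀ Ψ : Fin ℓ → L2 d, (∀ i, Ψ i ∈ paleyWiener Ω) →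
      shiftSpan Λ (Set.range Ψ) ≤ paleyWiener Ω := by
    intro Ψ hΨ
    refine shiftSpan_le ?_
    rintro v - _ ⟨k, rfl⟩
    exact translate_mem_paleyWiener v (hΨ k)
  have hΦPW : ∀ k, Φ k ∈ paleyWiener Ω := by
    intro k
    rw [mem_paleyWiener]
    filter_upwards [hΦ k, ae_all_iff.mpr fun i ↦
      mem_paleyWiener.mp (proj_mem (paleyWiener Ω) (F i))] with ω h1 h2 hω
    exact h1 fun i ↦ h2 i hω
  refine ⟨Φ, ⟨shiftSpan_range_mem_sisClass Φ, hle Φ hΦPW⟩, fun Ψ hΨ ↦ ?_, fun S hS ↦ ?_⟩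
  -- Both errors share the distance from `F` to the Paley-Wiener space, so only the errors of the
  -- projected data are compared.
  · rw [error_eq_add_error_proj F (hle Φ hΦPW), error_eq_add_error_proj F (hle Ψ hΨ)]
    exact add_le_add_right (hopt Ψ) _
  · obtain ⟨Ψ, rfl⟩ := exists_shiftSpan_range_eq hS
    exact hopt Ψ
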